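/- A semiflow $(T,X)$ consists of a topological semigroup $T$ with identity $e$ and a compact Hausdorff space $X$ (not necessarily metrizable), together with a jointly continuous action $T\times X\to X$, $(t,x)\mapsto tx$, such that $ex=x$ and $(st)x=s(tx)$. Let $\mathscr U_X$ be the unique compatible uniformity of $X$. The semiflow is * minimal if $Tx$ is dense in $X$ for every $x\in X$; * equicontinuous if for every $\varepsilon\in\mathscr U_X$ there is $\delta\in\mathscr U_X$ such that $(tx,tx')\in\varepsilon$ for all $(x,x')\in\delta$ and $t\in T$; * invertible if $x\mapsto tx$ is a bijection of $X$ for every $t\in T$; * distal if for all $x\ne x'$ in $X$ there is $\varepsilon\in\mathscr U_X$ with $(tx,tx')\notin\varepsilon$ for all $t\in T$. It admits an invariant measure if there is a Borel probability measure $\mu$ on $X$ with $\mu(t^{-1}B)=\mu(B)$ for all Borel $B\subseteq X$ and all $t\in T$. The semigroup $T$ is amenable if every semiflow of $T$ on a nonempty compact Hausdorff space admits an invariant measure. The equicontinuous structure relation $S_{eq}(X)$ is the least closed $T$-invariant equivalence relation $R$ on $X$ for which the factor semiflow $(T,X/R)$, $t[x]=[tx]$, is equicontinuous; $X_{eq}=X/S_{eq}(X)$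 is the maximal equicontinuous factor. The regionally proximal relation $Q(X)$ is the set of all $(x,x')\in X\times X$ for which there are nets $x_n\to x$ and $x_n'\to x'$ in $X$ and $t_n\in T$ such that $\lim_n t_nx_n=\lim_n t_nx_n'$. **Theorem.** Let $(T,X)$ be a minimal semiflow. Suppose that at least one of the following holds: (i) $(T,X)$ admits an invariant measure; (ii) $T$ is amenable; (iii) $(T,X)$ is distal. Then $S_{eq}(X)=Q(X)$, and the maximal equicontinuous factor $(T,X_{eq})$ is equicontinuous and invertible. -/

import Mathlib

open Set Filter Topology MeasureTheory

universe u v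

/-!
A semiflow `(T, X)` is given by a topological monoid `T` (`Monoid T`, `TopologicalSpace T`,
`ContinuousMul T`), a compact Hausdorff space `X` (`CompactSpace X`, `T2Space X`) and a jointly
continuous action (`MulAction T X`, `ContinuousSMul T X`). Minimality (every orbit is dense) is
Mathlib's `MulAction.IsMinimal T X`.
-/

namespace Semiflow

/-- The compatible uniform structure of a compact Hausdorff space: the neighbourhoods of the
diagonal (see `entourages_eq_uniformity`). -/
def entourages (X : Type v) [TopologicalSpace X] : Filter (X × X) :=
  𝓝ˢ (diagonal X)

theorem entourages_eq_uniformity (X : Type v) [UniformSpace X] [CompactSpace X] :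
    entourages X = uniformity X :=
  nhdsSet_diagonal_eq_uniformity

section Action

variable (T : Type u) (X : Type v) [TopologicalSpace X] [Monoid T] [MulAction T X]

/-- There is a Borel probability measure `μ` on `X` such that `μ (t⁻¹ B) = μ B` for all Borel sets
`B` and all `t`. (No regularity is required.) -/
def AdmitsInvariantMeasure : Prop :=
  letI : MeasurableSpace X := borel X
  ∃ μ : Measure X, IsProbabilityMeasure μ ∧ SMulInvariantMeasure T X μ

/-- Each `x ↦ t x` is a bijection of `X`. -/
def IsInvertible : Prop :=
  ∀ t : T, Function.Bijective fun x : X => t • x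

/-- For each entourage `ε` there is an entourage `δ` with `T δ ⊆ ε`. -/
def IsEquicontinuous : Prop :=
  ∀ ε ∈ entourages X, ∃ δ ∈ entourages X, ∀ p ∈ δ, ∀ t : T, (t • p.1, t • p.2) ∈ ε

/-- Distinct points stay apart, up to a fixed entourage, along their orbits. -/
def IsDistal : Prop :=
  ∀ x x' : X, x ≠ x' → ∃ ε ∈ entourages X, ∀ t : T, (t • x, t • x') ∉ ε

/-- The regionally proximal relation `Q(X)`: the pairs `(x, x')` for which there are nets `xₙ → x`,
`xₙ' → x'` in `X` and `tₙ` in `T` such that `lim tₙ xₙ = lim tₙ xₙ'`. -/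
def regionallyProximal : Set (X × X) :=
  {p | ∃ (ι : Type v) (_ : Preorder ι) (_ : IsDirectedOrder ι) (_ : Nonempty ι)
      (a b : ι → X) (t : ι → T) (z : X),
      Tendsto a atTop (𝓝 p.1) ∧ Tendsto b atTop (𝓝 p.2) ∧
      Tendsto (fun n => t n • a n) atTop (𝓝 z) ∧ Tendsto (fun n => t n • b n) atTop (𝓝 z)}

/-- The description of `Q(X)` as `⋂ α, closure (⋃ t, t⁻¹ α)`; in particular, nets indexed by types
of the universe of `X` suffice. -/
theorem regionallyProximal_eq [CompactSpace X] [T2Space X] :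
    regionallyProximal T X =
      ⋂ α ∈ entourages X, closure (⋃ t : T, {p : X × X | (t • p.1, t • p.2) ∈ α}) := by
  ext ⟨x, y⟩
  simp only [mem_iInter]
  constructor
  · rintro ⟨ι, _, _, _, a, b, t, z, ha, hb, hza, hzb⟩ α hα
    have hz : Tendsto (fun n => (t n • a n, t n • b n)) atTop (𝓝 (z, z)) := by
      rw [nhds_prod_eq]
      exact hza.prodMk hzb
    have hα' : α ∈ 𝓝 (z, z) := mem_nhdsSet_iff_forall.1 hα (z, z) rfl
    have hab : Tendsto (fun n => (a n, b n)) atTop (𝓝 (x, y)) := by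
      rw [nhds_prod_eq]
      exact ha.prodMk hb
    refine mem_closure_of_tendsto hab ?_
    filter_upwards [hz hα'] with n hn
    exact mem_iUnion.2 ⟨t n, hn⟩
  · intro h
    let g : (X × X) × T → X × X := fun q => (q.2 • q.1.1, q.2 • q.1.2)
    let F : Filter ((X × X) × T) := comap Prod.fst (𝓝 (x, y)) ⊓ comap g (entourages X)
    have hF : F.NeBot := by
      refine ((basis_sets _).comap _ |>.inf ((basis_sets _).comap _)).neBot_iff.2 ?_
      rintro ⟨s, α⟩ ⟨hs, hα⟩
      obtain ⟨p, hp, hp'⟩ := mem_closure_iff_nhds.1 (h α hα) s hs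
      obtain ⟨t, ht⟩ := mem_iUnion.1 hp'
      exact ⟨(p, t), hp, ht⟩
    obtain ⟨⟨z, w⟩, hc⟩ := exists_clusterPt_of_compactSpace (map g F)
    have hzw : z = w := by
      by_contra hne
      have hN : (diagonal X)ᶜ ∈ 𝓝 (z, w) := isClosed_diagonal.isOpen_compl.mem_nhds hne
      obtain ⟨N, ⟨hN1, hN2⟩, hN3⟩ := (closed_nhds_basis (z, w)).mem_iff.1 hN
      have hE : Nᶜ ∈ entourages X :=
        hN2.isOpen_compl.mem_nhdsSet.2 (subset_compl_comm.1 hN3)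
      have hm : Nᶜ ∈ map g F := mem_inf_of_right (preimage_mem_comap hE)
      obtain ⟨q, hq, hq'⟩ := clusterPt_iff_nonempty.1 hc hN1 hm
      exact hq' hq
    subst hzw
    have key (i : (𝓝 (x, y)).sets × (𝓝 (z, z)).sets) :
        ∃ q : (X × X) × T, q.1 ∈ i.1.1 ∧ g q ∈ i.2.1 := by
      have hm : g '' (Prod.fst ⁻¹' i.1.1) ∈ map g F :=
        image_mem_map (mem_inf_of_left (preimage_mem_comap i.1.2))
      obtain ⟨_, h1, ⟨q, hq, rfl⟩⟩ := clusterPt_iff_nonempty.1 hc i.2.2 hm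
      exact ⟨q, hq, h1⟩
    choose q hq1 hq2 using key
    let ι := ((𝓝 (x, y)).sets × (𝓝 (z, z)).sets)ᵒᵈ
    have hdir : IsDirectedOrder ι := by
      refine ⟨fun i j => ⟨(⟨i.1.1 ∩ j.1.1, inter_mem i.1.2 j.1.2⟩,
        ⟨i.2.1 ∩ j.2.1, inter_mem i.2.2 j.2.2⟩), ?_, ?_⟩⟩
      · exact ⟨inter_subset_left, inter_subset_left⟩
      · exact ⟨inter_subset_right, inter_subset_right⟩
    have hne : Nonempty ι := ⟨(⟨univ, univ_mem⟩, ⟨univ, univ_mem⟩)⟩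
    have l1 : Tendsto (fun i : ι => (q i).1) atTop (𝓝 (x, y)) := by
      intro s hs
      let i₀ : ι := (⟨s, hs⟩, ⟨univ, univ_mem⟩)
      rw [mem_map]
      filter_upwards [eventually_ge_atTop i₀] with i hi
      exact (show i.1.1 ⊆ s from hi.1) (hq1 i)
    have l2 : Tendsto (fun i : ι => g (q i)) atTop (𝓝 (z, z)) := by
      intro s hs
      let i₀ : ι := (⟨univ, univ_mem⟩, ⟨s, hs⟩)
      rw [mem_map]
      filter_upwards [eventually_ge_atTop i₀] with i hi
      exact (show i.2.1 ⊆ s from hi.2) (hq2 i)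
    exact ⟨ι, inferInstance, hdir, hne, fun i => (q i).1.1, fun i => (q i).1.2, fun i => (q i).2, z,
      (continuous_fst.tendsto _).comp l1, (continuous_snd.tendsto _).comp l1,
      (continuous_fst.tendsto _).comp l2, (continuous_snd.tendsto _).comp l2⟩

/-- A closed invariant equivalence relation on `X`. -/
structure ICER extends Setoid X where
  isClosed : IsClosed {p : X × X | toSetoid p.1 p.2}
  smul_rel : ∀ (t : T) {x y : X}, toSetoid x y → toSetoid (t • x) (t • y)

end Action

/-- A topological monoid `T` is amenable if every semiflow of `T` on a nonempty compact Hausdorff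
space has an invariant Borel probability measure. The phase spaces range over the universe `v`; the
condition for a larger universe implies the condition for a smaller one. -/
def IsAmenable (T : Type u) [Monoid T] [TopologicalSpace T] : Prop :=
  ∀ (Y : Type v) [TopologicalSpace Y] [CompactSpace Y] [T2Space Y] [Nonempty Y]
    [MulAction T Y] [ContinuousSMul T Y], AdmitsInvariantMeasure T Y

namespace ICER

variable {T : Type u} {X : Type v} [TopologicalSpace X] [Monoid T] [MulAction T X]

/-- The factor space `X / R`, with the quotient topology. -/
def Factor (R : ICER T X) : Type v := Quotient R.toSetoid

/-- The canonical projection `X → X / R`. -/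
def proj (R : ICER T X) (x : X) : R.Factor := Quotient.mk R.toSetoid x

instance (R : ICER T X) : TopologicalSpace R.Factor :=
  inferInstanceAs (TopologicalSpace (Quotient R.toSetoid))

/-- The induced action `t [x] = [t x]`. -/
instance (R : ICER T X) : MulAction T R.Factor where
  smul t := Quotient.map (fun x => t • x) fun _ _ h => R.smul_rel t h
  one_smul q := Quotient.inductionOn q fun x => congrArg (Quotient.mk _) (one_smul T x)
  mul_smul s t q := Quotient.inductionOn q fun x => congrArg (Quotient.mk _) (mul_smul s t x)

theorem smul_proj (R : ICER T X) (t : T) (x : X) : t • R.proj x = R.proj (t • x) := rfl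

theorem proj_surjective (R : ICER T X) : Function.Surjective R.proj := Quotient.mk_surjective

theorem continuous_proj (R : ICER T X) : Continuous R.proj := continuous_quot_mk

theorem proj_eq_iff (R : ICER T X) {x y : X} : R.proj x = R.proj y ↔ R.toSetoid x y :=
  Quotient.eq

instance [CompactSpace X] (R : ICER T X) : CompactSpace R.Factor :=
  inferInstanceAs (CompactSpace (Quotient R.toSetoid))

theorem isClosedMap_proj [CompactSpace X] (R : ICER T X) : IsClosedMap R.proj := by
  intro C hC
  have hq : IsQuotientMap R.proj := isQuotientMap_quot_mk
  rw [← hq.isClosed_preimage]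
  have hEq : R.proj ⁻¹' (R.proj '' C) =
      Prod.snd '' ({p : X × X | R.toSetoid p.1 p.2} ∩ Prod.fst ⁻¹' C) := by
    ext y
    simp only [mem_preimage, mem_image, mem_inter_iff, mem_ofPred_eq, Prod.exists, proj_eq_iff]
    constructor
    · rintro ⟨x, hx, h⟩
      exact ⟨x, y, ⟨h, hx⟩, rfl⟩
    · rintro ⟨x, y', ⟨h, hx⟩, rfl⟩
      exact ⟨x, hx, h⟩
  rw [hEq]
  exact isClosedMap_snd_of_compactSpace _ (R.isClosed.inter (hC.preimage continuous_fst))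

instance [CompactSpace X] [T2Space X] (R : ICER T X) : T2Space R.Factor := by
  have hcl (a : R.Factor) : IsClosed (R.proj ⁻¹' {a}) := by
    obtain ⟨x, rfl⟩ := R.proj_surjective a
    have h := R.isClosedMap_proj {x} isClosed_singleton
    rw [image_singleton] at h
    exact h.preimage R.continuous_proj
  refine ⟨fun a b hab => ?_⟩
  have hd : Disjoint (R.proj ⁻¹' {a}) (R.proj ⁻¹' {b}) :=
    Disjoint.preimage _ (disjoint_singleton.2 hab)
  obtain ⟨U, V, hU, hV, haU, hbV, hUV⟩ := normal_separation (hcl a) (hcl b) hd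
  refine ⟨(R.proj '' Uᶜ)ᶜ, (R.proj '' Vᶜ)ᶜ, (R.isClosedMap_proj _ hU.isClosed_compl).isOpen_compl,
    (R.isClosedMap_proj _ hV.isClosed_compl).isOpen_compl, ?_, ?_, ?_⟩
  · rintro ⟨x, hx, rfl⟩
    exact hx (haU rfl)
  · rintro ⟨x, hx, rfl⟩
    exact hx (hbV rfl)
  · rw [Set.disjoint_left]
    intro c hc hc'
    obtain ⟨x, rfl⟩ := R.proj_surjective c
    have h1 : x ∈ U := by_contra fun h => hc ⟨x, h, rfl⟩
    have h2 : x ∈ V := by_contra fun h => hc' ⟨x, h, rfl⟩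
    exact Set.disjoint_left.1 hUV h1 h2

instance [TopologicalSpace T] [CompactSpace X] [T2Space X] [ContinuousSMul T X] (R : ICER T X) :
    ContinuousSMul T R.Factor where
  continuous_smul := by
    have hp : IsProperMap (Prod.map id R.proj : T × X → T × R.Factor) :=
      isProperMap_id.prodMap R.continuous_proj.isProperMap
    have hq : IsQuotientMap (Prod.map id R.proj : T × X → T × R.Factor) :=
      hp.isClosedMap.isQuotientMap hp.continuous
        (Function.surjective_id.prodMap R.proj_surjective)
    rw [hq.continuous_iff]
    exact R.continuous_proj.comp continuous_smul

end ICER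

section Equicontinuous

variable (T : Type u) (X : Type v) [TopologicalSpace X] [Monoid T] [MulAction T X]

/-- The equicontinuous structure relation `S_eq(X)`: the least closed invariant equivalence
relation with an equicontinuous factor, obtained as the intersection of all such relations. -/
def equicontinuousStructureRelation : ICER T X where
  toSetoid := sInf {s | ∃ R : ICER T X, R.toSetoid = s ∧ IsEquicontinuous T R.Factor}
  isClosed := by
    have hEq : {p : X × X | (sInf {s : Setoid X | ∃ R : ICER T X, R.toSetoid = s ∧
        IsEquicontinuous T R.Factor}) p.1 p.2} =
        ⋂ (R : ICER T X) (_ : IsEquicontinuous T R.Factor),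
          {p : X × X | R.toSetoid p.1 p.2} := by
      ext p
      simp only [mem_iInter]
      constructor
      · intro h R hR
        exact h R.toSetoid ⟨R, rfl, hR⟩
      · rintro h _ ⟨R, rfl, hR⟩
        exact h R hR
    rw [hEq]
    exact isClosed_iInter fun R => isClosed_iInter fun _ => R.isClosed
  smul_rel := by
    rintro t x y h _ ⟨R, rfl, hR⟩
    exact R.smul_rel t (h R.toSetoid ⟨R, rfl, hR⟩)

/-- The maximal equicontinuous factor `X_eq = X / S_eq(X)`. -/
abbrev MaximalEquicontinuousFactor : Type v :=
  (equicontinuousStructureRelation T X).Factor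

end Equicontinuous

end Semiflow

/-! Each hypothesis makes every `x ↦ t • x` surjective; this gives invertibility and `Q ⊆ S_eq`. In
an equicontinuous semiflow by surjections, backward orbits recur, so the inverse relations are
equicontinuous too (`IsEquicontinuous.exists_entourage_of_surjective`). Hence `t` is injective on
the maximal equicontinuous factor, and a pair brought together by some `t` was already close modulo
`S_eq`.

The inclusion `S_eq ⊆ Q` has two proofs. With an invariant measure `ν`, which amenability also
provides, any closed invariant `N ⊆ X × X` yields an invariant continuous pseudometric `ν (N_x \
N_y)`, which must vanish on `S_eq`; one applies this to the orbit closure of `{x} × V`, with `V` a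
neighbourhood of `y`. In the distal case the enveloping semigroup is a compact group `E` with
continuous right translations. The points of `E` inseparable from `1` in the topology pushed forward
along `(p, q) ↦ p⁻¹ * q` form a normal subgroup. Its orbit relation on `X` has an equicontinuous
factor, so it contains `S_eq`, and inseparability places it inside `Q`. -/

namespace Semiflow

/-! ### Equicontinuous factors and the inclusion of `Q` in `S_eq` -/

section General

variable {T : Type u} {X : Type v} [TopologicalSpace X] [Monoid T] [MulAction T X]

theorem diagonal_mem_of_mem_entourages {α : Set (X × X)} (hα : α ∈ entourages X) (x : X) :
    (x, x) ∈ α :=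
  mem_of_mem_nhds (mem_nhdsSet_iff_forall.1 hα (x, x) rfl)

theorem mem_regionallyProximal_iff [CompactSpace X] [T2Space X] {x y : X} :
    (x, y) ∈ regionallyProximal T X ↔ ∀ α ∈ entourages X, ∀ O ∈ 𝓝 (x, y),
      ∃ p ∈ O, ∃ t : T, (t • p.1, t • p.2) ∈ α := by
  simp only [regionallyProximal_eq, mem_iInter, mem_closure_iff_nhds, Set.Nonempty, mem_inter_iff,
    mem_iUnion, mem_ofPred_eq]

theorem eq_of_forall_mem_entourages [CompactSpace X] [T2Space X] {x y : X}
    (h : ∀ α ∈ entourages X, (x, y) ∈ α) : x = y := by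
  by_contra hne
  have hα : {(x, y)}ᶜ ∈ entourages X := by
    refine isOpen_compl_singleton.mem_nhdsSet.2 ?_
    rintro ⟨a, b⟩ hab h
    obtain ⟨rfl, rfl⟩ := Prod.mk.inj h
    exact hne hab
  exact h _ hα rfl

theorem exists_isClosed_mem_entourages [CompactSpace X] [T2Space X] {α : Set (X × X)}
    (hα : α ∈ entourages X) : ∃ β ∈ entourages X, IsClosed β ∧ β ⊆ α := by
  let : UniformSpace X := uniformSpaceOfCompactR1
  rw [entourages_eq_uniformity] at *
  obtain ⟨β, ⟨hβ, hβc⟩, hβα⟩ := uniformity_hasBasis_closed.mem_iff.1 hα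
  exact ⟨β, hβ, hβc, hβα⟩

namespace ICER

/-- The relation as a subset of `X × X`. -/
def graph (R : ICER T X) : Set (X × X) := {p | R.toSetoid p.1 p.2}

theorem smul_factor_surjective (R : ICER T X) {t : T}
    (ht : Function.Surjective fun x : X => t • x) :
    Function.Surjective fun a : R.Factor => t • a := by
  intro a
  obtain ⟨x, rfl⟩ := R.proj_surjective a
  obtain ⟨y, rfl⟩ := ht x
  exact ⟨R.proj y, rfl⟩

variable [CompactSpace X] [T2Space X]

/-- The projection is a closed map, so equicontinuity of a factor can be tested upstairs, on
neighbourhoods of the graph. -/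
theorem nhdsSet_graph (R : ICER T X) :
    𝓝ˢ R.graph = comap (Prod.map R.proj R.proj) (entourages R.Factor) := by
  have hcont : Continuous (Prod.map R.proj R.proj) := R.continuous_proj.prodMap R.continuous_proj
  have hgraph : R.graph = Prod.map R.proj R.proj ⁻¹' diagonal R.Factor := by
    ext p
    exact R.proj_eq_iff.symm
  rw [hgraph, entourages, hcont.isClosedMap.comap_nhdsSet_eq hcont]

theorem isEquicontinuous_factor_iff (R : ICER T X) :
    IsEquicontinuous T R.Factor ↔ ∀ U ∈ 𝓝ˢ R.graph, ∃ V ∈ 𝓝ˢ R.graph, ∀ p ∈ V, ∀ t : T,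
      (t • p.1, t • p.2) ∈ U := by
  rw [nhdsSet_graph]
  constructor
  · rintro h U ⟨ε, hε, hεU⟩
    obtain ⟨δ, hδ, h⟩ := h ε hε
    exact ⟨_, preimage_mem_comap hδ, fun p hp t => hεU (h _ hp t)⟩
  · intro h ε hε
    obtain ⟨V, ⟨δ, hδ, hδV⟩, h⟩ := h _ (preimage_mem_comap hε)
    refine ⟨δ, hδ, ?_⟩
    rintro ⟨a, b⟩ hab t
    obtain ⟨x, rfl⟩ := R.proj_surjective a
    obtain ⟨y, rfl⟩ := R.proj_surjective b
    exact h (x, y) (hδV hab) t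

end ICER

theorem graph_equicontinuousStructureRelation :
    (equicontinuousStructureRelation T X).graph =
      ⋂ R : {R : ICER T X // IsEquicontinuous T R.Factor}, R.1.graph := by
  ext p
  simp only [mem_iInter]
  constructor
  · intro h R
    exact h R.1.toSetoid ⟨R.1, rfl, R.2⟩
  · rintro h _ ⟨R, rfl, hR⟩
    exact h ⟨R, hR⟩

theorem graph_equicontinuousStructureRelation_subset {R : ICER T X}
    (hR : IsEquicontinuous T R.Factor) :
    (equicontinuousStructureRelation T X).graph ⊆ R.graph := by
  rw [graph_equicontinuousStructureRelation]
  exact iInter_subset_of_subset ⟨R, hR⟩ Subset.rfl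

variable [CompactSpace X] [T2Space X]

/-- By compactness, finitely many closed neighbourhoods of graphs of equicontinuous relations
already intersect inside `U`; their moduli of equicontinuity are then intersected. -/
theorem isEquicontinuous_maximalEquicontinuousFactor :
    IsEquicontinuous T (MaximalEquicontinuousFactor T X) := by
  rw [ICER.isEquicontinuous_factor_iff]
  intro U hU
  let ι := Σ R : {R : ICER T X // IsEquicontinuous T R.Factor},
    {N : Set (X × X) // N ∈ 𝓝ˢ R.1.graph ∧ IsClosed N}
  have hsub : ⋂ i : ι, i.2.1 ⊆ interior U := by
    refine Subset.trans ?_ (subset_interior_iff_mem_nhdsSet.2 hU)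
    rw [graph_equicontinuousStructureRelation]
    refine subset_iInter fun R p hp => ?_
    by_contra hpR
    have hd : Disjoint R.1.graph {p} := disjoint_singleton_right.2 hpR
    obtain ⟨V, W, hV, hW, hRV, hpW, hVW⟩ :=
      normal_separation (R.1.isClosed : IsClosed R.1.graph) isClosed_singleton hd
    have hN : Wᶜ ∈ 𝓝ˢ R.1.graph :=
      mem_of_superset (hV.mem_nhdsSet.2 hRV) hVW.subset_compl_right
    exact mem_iInter.1 hp ⟨R, Wᶜ, hN, hW.isClosed_compl⟩ (hpW rfl)
  obtain ⟨s, hs⟩ := isOpen_interior.isClosed_compl.isCompact.elim_finite_subfamily_closed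
    (fun i : ι => i.2.1) (fun i => i.2.2.2)
    (disjoint_compl_left.mono_right hsub).inter_eq
  have hV (i : ι) : ∃ V ∈ 𝓝ˢ i.1.1.graph, ∀ p ∈ V, ∀ t : T, (t • p.1, t • p.2) ∈ i.2.1 :=
    i.1.1.isEquicontinuous_factor_iff.1 i.1.2 _ i.2.2.1
  choose V hV hVt using hV
  refine ⟨⋂ i ∈ s, V i, (biInter_finset_mem s).2 fun i _ =>
    nhdsSet_mono (graph_equicontinuousStructureRelation_subset i.1.2) (hV i), ?_⟩
  intro p hp t
  by_contra hpU
  have hmem : (t • p.1, t • p.2) ∈ (interior U)ᶜ ∩ ⋂ i ∈ s, i.2.1 :=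
    ⟨fun h => hpU (interior_subset h),
      mem_iInter₂.2 fun i hi => hVt i p (mem_iInter₂.1 hp i hi) t⟩
  rw [hs] at hmem
  exact hmem

/-- In an equicontinuous semiflow by surjections, the inverse relations are equicontinuous too. -/
theorem IsEquicontinuous.exists_entourage_of_surjective (heq : IsEquicontinuous T X)
    (hsurj : ∀ t : T, Function.Surjective fun x : X => t • x) {ε : Set (X × X)}
    (hε : ε ∈ entourages X) :
    ∃ δ ∈ entourages X, ∀ (t : T) (x y : X), (t • x, t • y) ∈ δ → (x, y) ∈ ε := by
  let : UniformSpace X := uniformSpaceOfCompactR1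
  rw [IsEquicontinuous] at heq
  rw [entourages_eq_uniformity] at *
  obtain ⟨ε₁, hε₁, hsymm, hcomp⟩ := comp_symm_mem_uniformity_sets hε
  obtain ⟨ε', hε', hsymm', hcomp'⟩ := comp_symm_mem_uniformity_sets hε₁
  obtain ⟨δ, hδ, hT⟩ := heq ε' hε'
  obtain ⟨γ, hγ, hγsymm, hγcomp⟩ := comp_symm_mem_uniformity_sets hδ
  refine ⟨δ, hδ, fun t x y hxy => ?_⟩
  -- Iterating a right inverse of `t`, which need not be continuous, produces backward orbits.
  obtain ⟨s, hs⟩ := (hsurj t).hasRightInverse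
  have hiter (k : ℕ) (z : X) : t ^ k • s^[k] z = z := by
    induction k with
    | zero => simp
    | succ k ih =>
      rw [Function.iterate_succ_apply', pow_succ, mul_smul]
      exact (congrArg (t ^ k • ·) (hs _)).trans ih
  obtain ⟨⟨a, b⟩, hab⟩ := exists_clusterPt_of_compactSpace
    (map (fun k : ℕ => (s^[k] x, s^[k] y)) atTop)
  have hW : {p : X × X | (a, p.1) ∈ γ ∧ (b, p.2) ∈ γ} ∈ 𝓝 (a, b) :=
    prod_mem_nhds (UniformSpace.ball_mem_nhds a hγ) (UniformSpace.ball_mem_nhds b hγ)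
  have hfreq := (mapClusterPt_iff_frequently.1 hab) _ hW
  rw [frequently_atTop] at hfreq
  obtain ⟨k, -, hk⟩ := hfreq 0
  -- Two backward times with close points: applying `t ^ l` shows that `t ^ (l - k)` almost fixes
  -- `x` and `y`. Strictness `k < l` leaves a factor `t` on which the assumption about `(t • x, t •
  -- y)` acts.
  obtain ⟨l, hkl, hl⟩ := hfreq (k + 1)
  have hrec (z c : X) (h₁ : (c, s^[k] z) ∈ γ) (h₂ : (c, s^[l] z) ∈ γ) :
      (t ^ (l - k) • z, z) ∈ ε' := by
    have h := hT (s^[k] z, s^[l] z) (hγcomp ⟨c, hγsymm.symm _ _ h₁, h₂⟩) (t ^ l)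
    have hl' : t ^ l = t ^ (l - k) * t ^ k := by
      rw [← pow_add]
      congr 1
      omega
    simp only [hiter] at h
    rwa [hl', mul_smul, hiter] at h
  have hx := hrec x a hk.1 hl.1
  have hy := hrec y b hk.2 hl.2
  have hm : (t ^ (l - k) • x, t ^ (l - k) • y) ∈ ε' := by
    have h := hT _ hxy (t ^ (l - k - 1))
    simp only [← mul_smul, ← pow_succ] at h
    rwa [show l - k - 1 + 1 = l - k by omega] at h
  exact hcomp ⟨t ^ (l - k) • y, hcomp' ⟨t ^ (l - k) • x, hsymm'.symm _ _ hx, hm⟩,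
    hcomp' ⟨y, hy, refl_mem_uniformity hε'⟩⟩

theorem isInvertible_maximalEquicontinuousFactor
    (hsurj : ∀ t : T, Function.Surjective fun x : X => t • x) :
    IsInvertible T (MaximalEquicontinuousFactor T X) := by
  intro t
  refine ⟨fun a b hab => eq_of_forall_mem_entourages fun α hα => ?_,
    (equicontinuousStructureRelation T X).smul_factor_surjective (hsurj t)⟩
  obtain ⟨δ, hδ, h⟩ := isEquicontinuous_maximalEquicontinuousFactor.exists_entourage_of_surjective
    (fun t => (equicontinuousStructureRelation T X).smul_factor_surjective (hsurj t)) hα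
  refine h t a b ?_
  rw [show t • a = t • b from hab]
  exact diagonal_mem_of_mem_entourages hδ _

/-- Equicontinuity of the inverse relations pulls closeness of `t • p.1` and `t • p.2` back to `p`
in the factor; closed entourages survive the limit `p → (x, y)`. -/
theorem regionallyProximal_subset_graph
    (hsurj : ∀ t : T, Function.Surjective fun x : X => t • x) :
    regionallyProximal T X ⊆ (equicontinuousStructureRelation T X).graph := by
  rintro ⟨x, y⟩ hxy
  set R := equicontinuousStructureRelation T X
  refine R.proj_eq_iff.1 (eq_of_forall_mem_entourages fun α hα => ?_)
  obtain ⟨β, hβ, hβc, hβα⟩ := exists_isClosed_mem_entourages hα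
  obtain ⟨δ, hδ, h⟩ := isEquicontinuous_maximalEquicontinuousFactor.exists_entourage_of_surjective
    (fun t => R.smul_factor_surjective (hsurj t)) hβ
  have hcont : Continuous (Prod.map R.proj R.proj) := R.continuous_proj.prodMap R.continuous_proj
  have hδ' : Prod.map R.proj R.proj ⁻¹' δ ∈ entourages X :=
    hcont.tendsto_nhdsSet (fun p hp => congrArg R.proj hp) hδ
  refine hβα (hβc.closure_subset (mem_closure_iff_nhds.2 fun O hO => ?_))
  obtain ⟨p, hp, t, ht⟩ := mem_regionallyProximal_iff.1 hxy _ hδ' _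
    (hcont.continuousAt.preimage_mem_nhds hO)
  exact ⟨_, hp, h t _ _ ht⟩

end General

/-! ### Compact groups with continuous right translations -/

section RightTopologicalGroup

variable {E : Type*} [Group E] [TopologicalSpace E]

/-- The sets which are open in the quotient topology on `E` induced by `(p, q) ↦ p⁻¹ * q`. -/
def IsDivOpen (V : Set E) : Prop := IsOpen {p : E × E | p.1⁻¹ * p.2 ∈ V}

/-- The closure with respect to the topology whose open sets are given by `IsDivOpen`. -/
def divClosure (V : Set E) : Set E := {x | ∀ O, IsDivOpen O → x ∈ O → (V ∩ O).Nonempty}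

theorem IsDivOpen.inter {V W : Set E} (hV : IsDivOpen V) (hW : IsDivOpen W) :
    IsDivOpen (V ∩ W) :=
  IsOpen.inter hV hW

theorem isDivOpen_biUnion {ι : Type*} {s : Set ι} {V : ι → Set E}
    (hV : ∀ i ∈ s, IsDivOpen (V i)) : IsDivOpen (⋃ i ∈ s, V i) := by
  have h : {p : E × E | p.1⁻¹ * p.2 ∈ ⋃ i ∈ s, V i} =
      ⋃ i ∈ s, {p : E × E | p.1⁻¹ * p.2 ∈ V i} := by
    ext p
    simp
  rw [IsDivOpen, h]
  exact isOpen_biUnion hV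

theorem IsDivOpen.preimage_inv {V : Set E} (hV : IsDivOpen V) :
    IsDivOpen ((fun x => x⁻¹) ⁻¹' V) := by
  have h := hV.preimage continuous_swap
  simpa [IsDivOpen, preimage] using h

theorem divClosure_mono {V W : Set E} (h : V ⊆ W) : divClosure V ⊆ divClosure W :=
  fun _ hx O hO hxO => (hx O hO hxO).mono (inter_subset_inter_left O h)

theorem isClosed_div_mem_divClosure (V : Set E) :
    IsClosed {p : E × E | p.1⁻¹ * p.2 ∈ divClosure V} := by
  have h : {p : E × E | p.1⁻¹ * p.2 ∈ divClosure V}ᶜ =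
      ⋃ O ∈ {O : Set E | IsDivOpen O ∧ ¬(V ∩ O).Nonempty}, {p : E × E | p.1⁻¹ * p.2 ∈ O} := by
    ext p
    simp only [divClosure, mem_compl_iff, mem_ofPred_eq, mem_iUnion, not_forall]
    constructor
    · rintro ⟨O, h₁, h₂, h₃⟩
      exact ⟨O, ⟨h₁, h₃⟩, h₂⟩
    · rintro ⟨O, ⟨h₁, h₃⟩, h₂⟩
      exact ⟨O, h₁, h₂, h₃⟩
  rw [← isOpen_compl_iff, h]
  exact isOpen_biUnion fun O hO => hO.1

section Translations

variable (hr : ∀ q : E, Continuous fun p : E => p * q)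
include hr

theorem IsDivOpen.preimage_mul_right {V : Set E} (hV : IsDivOpen V) (q : E) :
    IsDivOpen ((fun x => x * q) ⁻¹' V) := by
  have h := hV.preimage (continuous_fst.prodMk ((hr q).comp continuous_snd) :
    Continuous fun p : E × E => (p.1, p.2 * q))
  simpa only [IsDivOpen, preimage, mem_ofPred_eq, mul_assoc] using h

/-- Since `q * p⁻¹ * r = (p * q⁻¹)⁻¹ * r`, a left translation of the quotient comes from a right
translation upstairs, so left continuity in `E` is not needed. -/
theorem IsDivOpen.preimage_mul_left {V : Set E} (hV : IsDivOpen V) (q : E) :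
    IsDivOpen ((fun x => q * x) ⁻¹' V) := by
  have h := hV.preimage (((hr q⁻¹).comp continuous_fst).prodMk continuous_snd :
    Continuous fun p : E × E => (p.1 * q⁻¹, p.2))
  simpa only [IsDivOpen, preimage, mem_ofPred_eq, mul_assoc, mul_inv_rev, inv_inv, Function.comp_apply]
    using h

/-- The map `(p, q) ↦ p⁻¹ * q` is open: its fibres are orbits of diagonal left multiplication, and
density replaces an arbitrary multiplier by one in `D`, whose left translation is continuous. -/
theorem isDivOpen_image {D : Set E} (hD : Dense D) (hl : ∀ d ∈ D, Continuous fun p : E => d * p)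
    {W : Set (E × E)} (hW : IsOpen W) : IsDivOpen ((fun p : E × E => p.1⁻¹ * p.2) '' W) := by
  have h : {p : E × E | p.1⁻¹ * p.2 ∈ (fun p : E × E => p.1⁻¹ * p.2) '' W} =
      ⋃ d ∈ D, {p : E × E | (d * p.1, d * p.2) ∈ W} := by
    ext ⟨a, b⟩
    simp only [mem_ofPred_eq, mem_iUnion, mem_image, Prod.exists]
    constructor
    · rintro ⟨c, e, hce, h⟩
      have hO : IsOpen {r : E | (r * a, r * b) ∈ W} := hW.preimage ((hr a).prodMk (hr b))
      obtain ⟨d, hdW, hd⟩ := hD.inter_open_nonempty _ hO ⟨c * a⁻¹, by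
        have hb : c * a⁻¹ * b = e := by rw [mul_assoc, ← h, mul_inv_cancel_left]
        rwa [mem_ofPred_eq, inv_mul_cancel_right, hb]⟩
      exact ⟨d, hd, hdW⟩
    · rintro ⟨d, -, hd⟩
      exact ⟨_, _, hd, by group⟩
  rw [IsDivOpen, h]
  exact isOpen_biUnion fun d hd => hW.preimage
    (((hl d hd).comp continuous_fst).prodMk ((hl d hd).comp continuous_snd))

theorem mul_mem_divClosure {V : Set E} (hV : IsDivOpen V) {x n : E} (hx : x ∈ divClosure V)
    (hn : ∀ W : Set E, IsDivOpen W → 1 ∈ W → n ∈ divClosure W) : x * n ∈ divClosure V := by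
  intro O hO hxO
  obtain ⟨v, hv, hvO⟩ := hx _ (hO.preimage_mul_right hr n) hxO
  obtain ⟨w, hw, hwO⟩ := hn _ (hV.preimage_mul_left hr v) (by simpa using hv) _
    (hO.preimage_mul_left hr v) hvO
  exact ⟨v * w, hw, hwO⟩

/-- The points of `E` that cannot be separated from `1` by disjoint `IsDivOpen` sets. -/
def divKernel : Subgroup E where
  carrier := {n | ∀ W : Set E, IsDivOpen W → 1 ∈ W → n ∈ divClosure W}
  one_mem' := fun _ _ h1 _ _ h => ⟨1, h1, h⟩
  mul_mem' := fun ha hb W hW h1 => mul_mem_divClosure hr hW (ha W hW h1) hb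
  inv_mem' := by
    intro a ha W hW h1 O hO haO
    obtain ⟨w, hw, hwO⟩ := ha _ hW.preimage_inv (by simpa using h1) _ hO.preimage_inv haO
    exact ⟨w⁻¹, hw, hwO⟩

theorem mem_divKernel_iff {n : E} :
    n ∈ divKernel hr ↔ ∀ W : Set E, IsDivOpen W → 1 ∈ W → n ∈ divClosure W :=
  Iff.rfl

theorem normal_divKernel : (divKernel hr).Normal := by
  refine ⟨fun n hn g W hW h1 O hO hg => ?_⟩
  obtain ⟨w, hw, hwO⟩ := hn _ ((hW.preimage_mul_right hr g⁻¹).preimage_mul_left hr g)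
    (by simpa using h1) _ ((hO.preimage_mul_right hr g⁻¹).preimage_mul_left hr g) hg
  exact ⟨g * w * g⁻¹, hw, hwO⟩

theorem isClosed_div_mem_divKernel : IsClosed {p : E × E | p.1⁻¹ * p.2 ∈ divKernel hr} := by
  have h : {p : E × E | p.1⁻¹ * p.2 ∈ divKernel hr} =
      ⋂ W ∈ {W : Set E | IsDivOpen W ∧ 1 ∈ W}, {p : E × E | p.1⁻¹ * p.2 ∈ divClosure W} := by
    ext p
    simp [mem_divKernel_iff]
  rw [h]
  exact isClosed_biInter fun W _ => isClosed_div_mem_divClosure W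

theorem exists_isDivOpen_divKernel_subset [CompactSpace E] {U : Set (E × E)} (hU : IsOpen U)
    (hN : {p : E × E | p.1⁻¹ * p.2 ∈ divKernel hr} ⊆ U) :
    ∃ V : Set E, IsDivOpen V ∧ (divKernel hr : Set E) ⊆ V ∧
      {p : E × E | p.1⁻¹ * p.2 ∈ V} ⊆ U := by
  let ι := {W : Set E // IsDivOpen W ∧ 1 ∈ W}
  have : Nonempty ι := ⟨⟨univ, isOpen_univ, mem_univ _⟩⟩
  obtain ⟨⟨W, hW, h1⟩, hWU⟩ := hU.isClosed_compl.isCompact.elim_directed_family_closed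
    (fun W : ι => {p : E × E | p.1⁻¹ * p.2 ∈ divClosure W.1})
    (fun W => isClosed_div_mem_divClosure W.1)
    (by
      rw [← disjoint_iff_inter_eq_empty]
      refine disjoint_compl_left.mono_right (Subset.trans (fun p hp => ?_) hN)
      exact fun W hW h1 => mem_iInter.1 hp ⟨W, hW, h1⟩)
    (fun V W => ⟨⟨V.1 ∩ W.1, V.2.1.inter W.2.1, V.2.2, W.2.2⟩,
      fun p hp => divClosure_mono inter_subset_left hp,
      fun p hp => divClosure_mono inter_subset_right hp⟩)
  rw [← disjoint_iff_inter_eq_empty, disjoint_compl_left_iff_subset] at hWU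
  -- The set `W * N`, with `N` the kernel, is open and contains `N`; by `mul_mem_divClosure` it
  -- stays in the closure of `W`.
  refine ⟨⋃ n ∈ (divKernel hr : Set E), (fun x => x * n⁻¹) ⁻¹' W,
    isDivOpen_biUnion fun n _ => hW.preimage_mul_right hr n⁻¹, fun n hn => ?_,
    fun p hp => hWU ?_⟩
  · exact mem_iUnion₂.2 ⟨n, hn, by simpa using h1⟩
  · obtain ⟨n, hn, hp⟩ := mem_iUnion₂.1 hp
    have h := mul_mem_divClosure hr hW (x := p.1⁻¹ * p.2 * n⁻¹) (fun O _ hO => ⟨_, hp, hO⟩) hn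
    rwa [inv_mul_cancel_right] at h

end Translations

end RightTopologicalGroup

/-! ### Transitive actions of such groups: `S_eq` lies in `Q` -/

section GroupClosure

variable {T : Type u} {X : Type v} [TopologicalSpace X] [Monoid T] [MulAction T X]
  [CompactSpace X] [T2Space X]

theorem graph_subset_regionallyProximal_of_group {E : Type*} [Group E] [TopologicalSpace E]
    [CompactSpace E] (hr : ∀ q : E, Continuous fun p : E => p * q) [MulAction E X]
    [MulAction.IsPretransitive E X] (hev : ∀ x : X, Continuous fun p : E => p • x) {φ : T → E}
    (hφ : DenseRange φ) (hφX : ∀ (t : T) (x : X), φ t • x = t • x)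
    (hl : ∀ t : T, Continuous fun p : E => φ t * p) :
    (equicontinuousStructureRelation T X).graph ⊆ regionallyProximal T X := by
  rcases isEmpty_or_nonempty X with hX | ⟨⟨x₀⟩⟩
  · exact fun p => isEmptyElim p.1
  have hl' : ∀ d ∈ range φ, Continuous fun p : E => d * p := by
    rintro _ ⟨t, rfl⟩
    exact hl t
  set N := divKernel hr with hNdef
  have hnormal : N.Normal := normal_divKernel hr
  let F : E × E → X × X := fun p => (p.1 • x₀, p.2 • x₀)
  have hF : Continuous F :=
    ((hev x₀).comp continuous_fst).prodMk ((hev x₀).comp continuous_snd)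
  have hFsurj : Function.Surjective F := by
    rintro ⟨x, y⟩
    obtain ⟨p, rfl⟩ := MulAction.exists_smul_eq E x₀ x
    obtain ⟨q, rfl⟩ := MulAction.exists_smul_eq E x₀ y
    exact ⟨(p, q), rfl⟩
  have hrel (x y : X) : MulAction.orbitRel N X x y ↔
      ∃ p q : E, p⁻¹ * q ∈ N ∧ p • x₀ = x ∧ q • x₀ = y := by
    rw [MulAction.orbitRel_apply]
    constructor
    · rintro ⟨n, rfl⟩
      obtain ⟨q, rfl⟩ := MulAction.exists_smul_eq E x₀ y
      refine ⟨n * q, q, ?_, mul_smul _ _ _, rfl⟩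
      have h := hnormal.conj_mem _ (N.inv_mem n.2) q⁻¹
      simpa [mul_assoc] using h
    · rintro ⟨p, q, hpq, rfl, rfl⟩
      refine ⟨⟨p * q⁻¹, ?_⟩, ?_⟩
      · have h := hnormal.conj_mem _ (N.inv_mem hpq) p
        simpa [mul_assoc] using h
      · change (p * q⁻¹) • q • x₀ = p • x₀
        rw [smul_smul, inv_mul_cancel_right]
  let R : ICER T X :=
    { toSetoid := MulAction.orbitRel N X
      isClosed := by
        have h : {p : X × X | MulAction.orbitRel N X p.1 p.2} =
            F '' {p : E × E | p.1⁻¹ * p.2 ∈ N} := by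
          ext ⟨x, y⟩
          simp only [mem_ofPred_eq, hrel, mem_image, Prod.exists, F, Prod.mk.injEq]
        rw [h]
        exact ((isClosed_div_mem_divKernel hr).isCompact.image hF).isClosed
      smul_rel := by
        intro t x y h
        obtain ⟨p, q, hpq, rfl, rfl⟩ := (hrel x y).1 h
        refine (hrel _ _).2 ⟨φ t * p, φ t * q, by simpa [mul_assoc] using hpq, ?_, ?_⟩
        · rw [mul_smul, hφX]
        · rw [mul_smul, hφX] }
  have hgraph : R.graph = F '' {p : E × E | p.1⁻¹ * p.2 ∈ N} := by
    ext ⟨x, y⟩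
    simp only [mem_image, Prod.exists, F, Prod.mk.injEq]
    exact hrel x y
  have hR : IsEquicontinuous T R.Factor := by
    rw [R.isEquicontinuous_factor_iff]
    intro U hU
    obtain ⟨V, hV, hNV, hVU⟩ := exists_isDivOpen_divKernel_subset hr
      (isOpen_interior.preimage hF) (U := F ⁻¹' interior U) (by
        rw [← image_subset_iff, ← hNdef, ← hgraph]
        exact subset_interior_iff_mem_nhdsSet.2 hU)
    -- `F` forgets right multiplication by the stabilizer of `x₀`; this enlargement of `V` accounts
    -- for the ambiguity. Diagonal left multiplication preserves `p⁻¹ * q`, so the bound is uniform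
    -- in `t`.
    let V' : Set E := ⋃ h ∈ (MulAction.stabilizer E x₀ : Set E), (fun x => x * h) ⁻¹' V
    have hV' : IsDivOpen V' := isDivOpen_biUnion fun h _ => hV.preimage_mul_right hr h
    refine ⟨(F '' {p : E × E | p.1⁻¹ * p.2 ∈ V'}ᶜ)ᶜ, ?_, ?_⟩
    · refine (hF.isClosedMap _ (IsOpen.isClosed_compl hV')).isOpen_compl.mem_nhdsSet.2 ?_
      rw [hgraph]
      rintro _ ⟨⟨a, b⟩, hab, rfl⟩ ⟨⟨c, d⟩, hcd, hF'⟩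
      obtain ⟨h₁, h₂⟩ : c • x₀ = a • x₀ ∧ d • x₀ = b • x₀ := Prod.mk.inj hF'
      refine hcd (mem_iUnion₂.2 ⟨d⁻¹ * b * (a⁻¹ * c), ?_, hNV ?_⟩)
      · simp only [SetLike.mem_coe, MulAction.mem_stabilizer_iff, mul_smul, h₁, inv_smul_smul,
          ← h₂]
      · have h := hnormal.conj_mem _ hab (c⁻¹ * a)
        simpa [mul_assoc] using h
    · intro p hp t
      obtain ⟨⟨a, b⟩, rfl⟩ := hFsurj p
      have hab : a⁻¹ * b ∈ V' := by
        by_contra hab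
        exact hp ⟨(a, b), hab, rfl⟩
      obtain ⟨h, hh, hab⟩ := mem_iUnion₂.1 hab
      have hU' : F (φ t * a, φ t * (b * h)) ∈ interior U := by
        refine @hVU (φ t * a, φ t * (b * h)) ?_
        simpa [mul_assoc] using hab
      have hh' : h • x₀ = x₀ := hh
      simp only [F, mul_smul, hφX, hh'] at hU'
      exact interior_subset hU'
  refine (graph_equicontinuousStructureRelation_subset hR).trans ?_
  rw [hgraph]
  rintro _ ⟨⟨p, q⟩, hpq, rfl⟩
  refine mem_regionallyProximal_iff.2 fun α hα O hO => ?_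
  -- Inseparability of `p⁻¹ * q` from `1` gives a pair near `(p, q)` and a pair sent into `α` with
  -- the same quotient; they differ by a left multiplier, which density lets some `φ t` replace.
  obtain ⟨e, he, he'⟩ := hpq _
    (isDivOpen_image hr hφ hl' (isOpen_interior.preimage hF) (W := F ⁻¹' interior α))
    ⟨(1, 1), subset_interior_iff_mem_nhdsSet.2 hα rfl, by simp⟩ _
    (isDivOpen_image hr hφ hl' (isOpen_interior.preimage hF) (W := F ⁻¹' interior O))
    ⟨(p, q), mem_interior_iff_mem_nhds.2 hO, rfl⟩
  obtain ⟨⟨c, d⟩, hcd, rfl⟩ := he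
  obtain ⟨⟨a, b⟩, hab, h⟩ := he'
  have hopen : IsOpen {r : E | F (r * a, r * b) ∈ interior α} :=
    isOpen_interior.preimage (hF.comp ((hr a).prodMk (hr b)))
  obtain ⟨t, ht⟩ := hφ.exists_mem_open hopen ⟨c * a⁻¹, by
    have hb : c * a⁻¹ * b = d := by
      rw [mul_assoc, show a⁻¹ * b = c⁻¹ * d from h, mul_inv_cancel_left]
    rw [mem_ofPred_eq, inv_mul_cancel_right, hb]
    exact hcd⟩
  refine ⟨F (a, b), interior_subset hab, t, ?_⟩
  have ht' := interior_subset ht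
  simpa only [F, mul_smul, hφX] using ht'

end GroupClosure

/-! ### Distal semiflows and their enveloping semigroup -/

section Distal

variable (T : Type u) (X : Type v) [TopologicalSpace X] [Monoid T] [MulAction T X]

/-- The enveloping semigroup: the closure of `T` in `X → X` for the topology of pointwise
convergence. -/
abbrev EnvelopingSemigroup : Type v := closure (range fun (t : T) (x : X) => t • x)

variable {T X}

/-- The image of `t` in the enveloping semigroup. -/
def EnvelopingSemigroup.of (t : T) : EnvelopingSemigroup T X :=
  ⟨fun x => t • x, subset_closure ⟨t, rfl⟩⟩

theorem EnvelopingSemigroup.denseRange_of :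
    DenseRange (EnvelopingSemigroup.of : T → EnvelopingSemigroup T X) := by
  rintro ⟨p, hp⟩
  rw [closure_subtype, ← range_comp]
  exact hp

theorem continuous_eval_envelopingSemigroup (x : X) :
    Continuous fun p : EnvelopingSemigroup T X => p.1 x :=
  (continuous_apply x).comp continuous_subtype_val

theorem IsDistal.injective_envelopingSemigroup (hd : IsDistal T X) (p : EnvelopingSemigroup T X) :
    Function.Injective p.1 := by
  intro x y hxy
  by_contra hne
  obtain ⟨ε, hε, hT⟩ := hd x y hne
  have hopen : IsOpen {q : EnvelopingSemigroup T X | (q.1 x, q.1 y) ∈ interior ε} :=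
    isOpen_interior.preimage
      ((continuous_eval_envelopingSemigroup x).prodMk (continuous_eval_envelopingSemigroup y))
  obtain ⟨t, ht⟩ := EnvelopingSemigroup.denseRange_of.exists_mem_open hopen
    ⟨p, subset_interior_iff_mem_nhdsSet.2 hε hxy⟩
  exact hT t (interior_subset ht)

variable [ContinuousConstSMul T X]

instance : Monoid (EnvelopingSemigroup T X) where
  mul p q := ⟨p.1 ∘ q.1, by
    have hcont (r : X → X) : Continuous fun s : X → X => s ∘ r :=
      continuous_pi fun x => continuous_apply (r x)
    -- Right composition is always continuous, so `p` reduces to some `t`; left composition by `t`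
    -- is then continuous, so `q` reduces as well.
    refine closure_minimal ?_ (isClosed_closure.preimage (hcont q.1)) p.2
    rintro _ ⟨t, rfl⟩
    have hcont' : Continuous fun s : X → X => (fun x => t • x) ∘ s :=
      continuous_pi fun x => (continuous_apply x).const_smul t
    refine closure_minimal ?_ (isClosed_closure.preimage hcont') q.2
    rintro _ ⟨s, rfl⟩
    refine subset_closure ⟨t * s, ?_⟩
    funext x
    exact mul_smul t s x⟩
  one := ⟨id, subset_closure ⟨1, funext fun x => one_smul T x⟩⟩
  mul_assoc _ _ _ := rfl
  one_mul _ := rfl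
  mul_one _ := rfl

instance : MulAction (EnvelopingSemigroup T X) X where
  smul p x := p.1 x
  one_smul _ := rfl
  mul_smul _ _ _ := rfl

theorem EnvelopingSemigroup.continuous_mul_right (q : EnvelopingSemigroup T X) :
    Continuous fun p : EnvelopingSemigroup T X => p * q :=
  (continuous_pi fun x => continuous_eval_envelopingSemigroup (q.1 x)).subtype_mk _

theorem EnvelopingSemigroup.continuous_of_mul (t : T) :
    Continuous fun p : EnvelopingSemigroup T X => of t * p :=
  (continuous_pi fun x => (continuous_eval_envelopingSemigroup x).const_smul t).subtype_mk _

variable [CompactSpace X] [T2Space X]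

instance : CompactSpace (EnvelopingSemigroup T X) :=
  isCompact_iff_compactSpace.1 isClosed_closure.isCompact

/-- The compact left ideal generated by `p` contains an idempotent, and an injective idempotent is
the identity. -/
theorem IsDistal.exists_mul_eq_one (hd : IsDistal T X) (p : EnvelopingSemigroup T X) :
    ∃ q : EnvelopingSemigroup T X, q * p = 1 := by
  obtain ⟨_, ⟨q, rfl⟩, h⟩ := exists_idempotent_in_compact_subsemigroup
    EnvelopingSemigroup.continuous_mul_right (range fun q => q * p) ⟨_, 1, rfl⟩
    (isCompact_range (EnvelopingSemigroup.continuous_mul_right p)) (by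
      rintro _ ⟨a, rfl⟩ _ ⟨b, rfl⟩
      exact ⟨a * p * b, mul_assoc _ _ _⟩)
  refine ⟨q, Subtype.ext (funext fun x => ?_)⟩
  exact hd.injective_envelopingSemigroup (q * p) (congrFun (congrArg Subtype.val h) x)

/-- The enveloping semigroup of a distal semiflow is a group. -/
noncomputable abbrev IsDistal.envelopingGroup (hd : IsDistal T X) :
    Group (EnvelopingSemigroup T X) :=
  { (inferInstance : Monoid (EnvelopingSemigroup T X)) with
    inv := fun p => (hd.exists_mul_eq_one p).choose
    inv_mul_cancel := fun p => (hd.exists_mul_eq_one p).choose_spec }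

theorem IsDistal.smul_surjective (hd : IsDistal T X) (t : T) :
    Function.Surjective fun x : X => t • x := by
  let := hd.envelopingGroup
  intro x
  exact ⟨((EnvelopingSemigroup.of t : EnvelopingSemigroup T X)⁻¹).1 x,
    congrFun (congrArg Subtype.val (mul_inv_cancel (EnvelopingSemigroup.of t))) x⟩

theorem IsDistal.graph_subset_regionallyProximal (hd : IsDistal T X)
    (hmin : MulAction.IsMinimal T X) :
    (equicontinuousStructureRelation T X).graph ⊆ regionallyProximal T X := by
  let := hd.envelopingGroup
  have : MulAction.IsPretransitive (EnvelopingSemigroup T X) X := by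
    refine ⟨fun x y => ?_⟩
    have hcl : IsClosed (range fun p : EnvelopingSemigroup T X => p.1 x) :=
      (isCompact_range (continuous_eval_envelopingSemigroup x)).isClosed
    have hsub : MulAction.orbit T x ⊆ range fun p : EnvelopingSemigroup T X => p.1 x := by
      rintro _ ⟨t, rfl⟩
      exact ⟨EnvelopingSemigroup.of t, rfl⟩
    exact closure_minimal hsub hcl (hmin.dense_orbit x y)
  exact graph_subset_regionallyProximal_of_group (T := T) (X := X)
    (E := EnvelopingSemigroup T X) EnvelopingSemigroup.continuous_mul_right
    continuous_eval_envelopingSemigroup EnvelopingSemigroup.denseRange_of (fun _ _ => rfl)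
    EnvelopingSemigroup.continuous_of_mul

end Distal

/-! ### Invariant pseudometrics and `S_eq` -/

section Pseudometric

variable {T : Type u} {X : Type v} [TopologicalSpace X] [Monoid T] [MulAction T X]
  [CompactSpace X] [T2Space X]

/-- A continuous pseudometric that the action does not increase vanishes on `S_eq(X)`. -/
theorem eq_zero_of_mem_graph {d : X → X → ℝ} (hself : ∀ x, d x x = 0)
    (hsymm : ∀ x y, d x y = d y x) (htri : ∀ x y z, d x z ≤ d x y + d y z)
    (hcont : ∀ x, ∀ ε > 0, ∀ᶠ y in 𝓝 x, d y x ≤ ε)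
    (hsmul : ∀ (t : T) (x y : X), d (t • x) (t • y) ≤ d x y) {p : X × X}
    (hp : p ∈ (equicontinuousStructureRelation T X).graph) : d p.1 p.2 = 0 := by
  have hnonneg (x y : X) : 0 ≤ d x y := by
    linarith [hself x, htri x y x, hsymm x y]
  have hd : Continuous fun p : X × X => d p.1 p.2 := by
    refine continuous_iff_continuousAt.2 fun ⟨x, y⟩ => Metric.tendsto_nhds.2 fun ε hε => ?_
    rw [nhds_prod_eq]
    filter_upwards [(hcont x (ε / 3) (by positivity)).prod_mk (hcont y (ε / 3) (by positivity))]
    rintro ⟨x', y'⟩ ⟨hx, hy⟩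
    simp only at hx hy ⊢
    rw [Real.dist_eq, abs_lt]
    constructor <;>
    linarith [htri x x' y, htri x' y' y, htri x' x y', htri x y y', hsymm x x', hsymm y y']
  let R : ICER T X :=
    { toSetoid :=
        { r := fun x y => d x y = 0
          iseqv :=
            { refl := hself
              symm := fun {x y} h => (hsymm y x).trans h
              trans := fun {x y z} h₁ h₂ => le_antisymm
                ((htri x y z).trans (by rw [h₁, h₂, add_zero])) (hnonneg x z) } }
      isClosed := isClosed_eq hd continuous_const
      smul_rel := fun t x y h => le_antisymm ((hsmul t x y).trans h.le) (hnonneg _ _) }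
  suffices hR : IsEquicontinuous T R.Factor from
    graph_equicontinuousStructureRelation_subset hR hp
  rw [R.isEquicontinuous_factor_iff]
  intro U hU
  have hRU : R.graph ⊆ interior U := subset_interior_iff_mem_nhdsSet.2 hU
  -- `ε` is the minimum of `d` on the compact complement; the sublevel set is carried into itself by
  -- the action.
  obtain ⟨ε, hε, hεU⟩ : ∃ ε > 0, {p : X × X | d p.1 p.2 < ε} ⊆ interior U := by
    rcases (interior U)ᶜ.eq_empty_or_nonempty with h | h
    · exact ⟨1, one_pos, by simp [compl_empty_iff.1 h]⟩
    · obtain ⟨q, hq, hmin⟩ :=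
        isOpen_interior.isClosed_compl.isCompact.exists_isMinOn h hd.continuousOn
      refine ⟨d q.1 q.2, (hnonneg _ _).lt_of_ne fun h0 => hq (hRU h0.symm), fun p hp => ?_⟩
      by_contra hpU
      exact not_lt.2 (isMinOn_iff.1 hmin p hpU) hp
  refine ⟨{p : X × X | d p.1 p.2 < ε},
    (isOpen_lt hd continuous_const).mem_nhdsSet.2 fun p hp => ?_, fun p hp t => ?_⟩
  · exact lt_of_eq_of_lt hp hε
  · exact interior_subset (hεU ((hsmul t p.1 p.2).trans_lt hp))

end Pseudometric

/-! ### Semiflows with an invariant measure -/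

section InvariantMeasure

theorem regular_map_of_continuous {X : Type*} [TopologicalSpace X] [T2Space X]
    [MeasurableSpace X] [BorelSpace X] (μ : Measure X) [IsFiniteMeasure μ] [μ.Regular]
    {f : X → X} (hf : Continuous f) : (μ.map f).Regular := by
  have : (μ.map f).InnerRegular := by
    refine ⟨fun B hB r hr => ?_⟩
    rw [Measure.map_apply hf.measurable hB] at hr
    obtain ⟨K, hK, hKc, hrK⟩ :=
      (hf.measurable hB).exists_lt_isCompact_of_ne_top (measure_ne_top μ _) hr
    refine ⟨f '' K, image_subset_iff.2 hK, hKc.image hf, hrK.trans_le ?_⟩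
    rw [Measure.map_apply hf.measurable (hKc.image hf).measurableSet]
    exact measure_mono (subset_preimage_image f K)
  infer_instance

variable {T : Type u} {X : Type v} [TopologicalSpace X] [Monoid T] [MulAction T X]
  [CompactSpace X]

/-- The Riesz measure of `f ↦ ∫ f dμ` is regular and has the same integrals. Its push-forwards are
regular too, so agreement on continuous functions gives invariance. -/
theorem exists_regular_measurePreserving [T2Space X] [MeasurableSpace X] [BorelSpace X]
    [ContinuousConstSMul T X] (μ : Measure X) [IsProbabilityMeasure μ]
    (hμ : ∀ t : T, MeasurePreserving (fun x : X => t • x) μ μ) :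
    ∃ ν : Measure X, ν ≠ 0 ∧ IsFiniteMeasure ν ∧ ν.Regular ∧
      ∀ t : T, MeasurePreserving (fun x : X => t • x) ν ν := by
  let Λ := CompactlySupportedContinuousMap.integralPositiveLinearMap μ
  have hΛ (f : CompactlySupportedContinuousMap X ℝ) :
      ∫ x, f x ∂(RealRMK.rieszMeasure Λ) = ∫ x, f x ∂μ := by
    rw [RealRMK.integral_rieszMeasure]
    rfl
  have hfin : IsFiniteMeasure (RealRMK.rieszMeasure Λ) := inferInstance
  refine ⟨RealRMK.rieszMeasure Λ, fun h0 => ?_, hfin, inferInstance, fun t => ?_⟩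
  · have h := hΛ ⟨1, HasCompactSupport.of_compactSpace _⟩
    simp [h0] at h
  · have ht : Continuous fun x : X => t • x := continuous_const_smul t
    refine ⟨ht.measurable, ?_⟩
    have := regular_map_of_continuous (RealRMK.rieszMeasure Λ) ht
    refine Measure.ext_of_integral_eq_on_compactlySupported fun f => ?_
    have hf : Continuous f := f.continuous
    rw [integral_map ht.aemeasurable hf.aestronglyMeasurable, hΛ,
      ← (integral_map ht.aemeasurable hf.aestronglyMeasurable).symm.trans
        (congrArg (fun κ => ∫ x, f x ∂κ) (hμ t).map_eq)]
    exact hΛ ⟨⟨fun x => f (t • x), hf.comp ht⟩, HasCompactSupport.of_compactSpace _⟩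

section Regular

variable [MeasurableSpace X] [BorelSpace X] {ν : Measure X}

/-- By minimality and compactness, finitely many preimages of a nonempty open set cover `X`; were it
null, all of `X` would be. -/
theorem isOpenPosMeasure_of_isMinimal [ContinuousConstSMul T X]
    (hmin : MulAction.IsMinimal T X) (hν : ν ≠ 0)
    (hT : ∀ t : T, MeasurePreserving (fun x : X => t • x) ν ν) : ν.IsOpenPosMeasure := by
  refine ⟨fun U hU hne h0 => hν ?_⟩
  obtain ⟨s, hs⟩ := isCompact_univ.elim_finite_subcover (fun t : T => (t • ·) ⁻¹' U)
    (fun t => hU.preimage (continuous_const_smul t)) (hU.iUnion_preimage_smul T hne).ge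
  refine Measure.measure_univ_eq_zero.1 (measure_mono_null hs ?_)
  refine (measure_biUnion_null_iff s.countable_toSet).2 fun t _ => ?_
  exact ((hT t).measure_preimage hU.measurableSet.nullMeasurableSet).trans h0

theorem smul_surjective_of_measurePreserving [T2Space X] [ContinuousConstSMul T X] [ν.IsOpenPosMeasure]
    {t : T} (ht : MeasurePreserving (fun x : X => t • x) ν ν) :
    Function.Surjective fun x : X => t • x := by
  have hcl : IsClosed (range fun x : X => t • x) :=
    (isCompact_range (continuous_const_smul t)).isClosed
  rw [← range_eq_univ, ← compl_empty_iff,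
    ← hcl.isOpen_compl.measure_eq_zero_iff ν,
    ← ht.measure_preimage hcl.measurableSet.compl.nullMeasurableSet, preimage_compl,
    preimage_range, compl_univ, measure_empty]

variable [T2Space X] [IsFiniteMeasure ν]

/-- Slices of a closed set are upper semicontinuous by compactness, and outer regularity bounds the
excess. -/
theorem eventually_measureReal_diff_le [ν.Regular] {N : Set (X × X)} (hN : IsClosed N) (x : X)
    {ε : ℝ} (hε : 0 < ε) :
    ∀ᶠ y in 𝓝 x, ν.real (Prod.mk y ⁻¹' N \ Prod.mk x ⁻¹' N) ≤ ε := by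
  have hNx : IsClosed (Prod.mk x ⁻¹' N) := hN.preimage (by fun_prop)
  obtain ⟨U, hNU, hU, hlt⟩ := hNx.measurableSet.exists_isOpen_sdiff_lt (measure_ne_top ν _)
    (ENNReal.ofReal_pos.2 hε).ne'
  have hcl : IsClosed (Prod.fst '' (N ∩ Prod.snd ⁻¹' Uᶜ)) :=
    isClosedMap_fst_of_compactSpace _ (hN.inter (hU.isClosed_compl.preimage continuous_snd))
  have hx : x ∉ Prod.fst '' (N ∩ Prod.snd ⁻¹' Uᶜ) := by
    rintro ⟨⟨_, y⟩, ⟨hy, hyU⟩, rfl⟩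
    exact hyU (hNU hy)
  filter_upwards [hcl.isOpen_compl.mem_nhds hx] with y hy
  have hsub : Prod.mk y ⁻¹' N \ Prod.mk x ⁻¹' N ⊆ U \ Prod.mk x ⁻¹' N := by
    refine sdiff_subset_sdiff_left fun z hz => ?_
    by_contra hzU
    exact hy ⟨(y, z), ⟨hz, hzU⟩, rfl⟩
  exact ENNReal.toReal_le_of_le_ofReal hε.le ((measure_mono hsub).trans hlt.2.le)

/-- For a closed invariant set `N`, the pairs in `S_eq(X)` have almost equal slices of `N`. -/
theorem measureReal_slice_diff_eq_zero [ν.Regular] (hmin : MulAction.IsMinimal T X)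
    (hT : ∀ t : T, MeasurePreserving (fun x : X => t • x) ν ν) {N : Set (X × X)}
    (hN : IsClosed N) (hNT : ∀ p ∈ N, ∀ t : T, (t • p.1, t • p.2) ∈ N) {p : X × X}
    (hp : p ∈ (equicontinuousStructureRelation T X).graph) :
    ν.real (Prod.mk p.1 ⁻¹' N \ Prod.mk p.2 ⁻¹' N) = 0 := by
  let S : X → Set X := fun x => Prod.mk x ⁻¹' N
  have hS (x : X) : MeasurableSet (S x) := (hN.preimage (by fun_prop)).measurableSet
  have hsub (t : T) (x : X) : S x ⊆ (t • ·) ⁻¹' S (t • x) := fun y hy => hNT (x, y) hy t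
  have hpre (t : T) {B : Set X} (hB : MeasurableSet B) : ν.real ((t • ·) ⁻¹' B) = ν.real B :=
    (hT t).measureReal_preimage hB.nullMeasurableSet
  -- The slice measure does not decrease along orbits and is upper semicontinuous, so minimality
  -- makes it constant.
  have hle (x y : X) : ν.real (S x) ≤ ν.real (S y) := by
    refine le_of_forall_pos_le_add fun ε hε => ?_
    obtain ⟨_, hz, ⟨t, rfl⟩⟩ := mem_closure_iff_nhds.1 (hmin.dense_orbit x y) _
      (eventually_measureReal_diff_le (ν := ν) hN y hε)
    calc ν.real (S x) ≤ ν.real (S (t • x)) := (measureReal_mono (hsub t x)).trans_eq (hpre t (hS _))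
      _ ≤ ν.real (S y ∪ S (t • x) \ S y) := measureReal_mono (by rw [union_sdiff_self]; simp)
      _ ≤ ν.real (S y) + ν.real (S (t • x) \ S y) := measureReal_union_le _ _
      _ ≤ ν.real (S y) + ε := by gcongr; exact hz
  have hconst (x y : X) : ν.real (S x) = ν.real (S y) := le_antisymm (hle x y) (hle y x)
  refine eq_zero_of_mem_graph (d := fun x y => ν.real (S x \ S y)) (fun x => by simp)
    (fun x y => ?_) (fun x y z => ?_)
    (fun x ε hε => eventually_measureReal_diff_le hN x hε) (fun t x y => ?_) hp
  · have h₁ := measureReal_sdiff_add_inter (μ := ν) (s := S x) (hS y)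
    have h₂ := measureReal_sdiff_add_inter (μ := ν) (s := S y) (hS x)
    rw [inter_comm] at h₂
    linarith [hconst x y]
  · refine (measureReal_mono ?_).trans (measureReal_union_le _ _)
    intro w hw
    by_cases hy : w ∈ S y
    · exact Or.inr ⟨hy, hw.2⟩
    · exact Or.inl ⟨hw.1, hy⟩
  -- Constancy turns the inclusion `S x ⊆ t⁻¹ S (t • x)` into equality up to a null set.
  · have h0 : ν.real ((t • ·) ⁻¹' S (t • x) \ S x) = 0 := by
      rw [measureReal_sdiff (hsub t x) (hS x), hpre t (hS _), hconst (t • x) x, sub_self]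
    calc ν.real (S (t • x) \ S (t • y))
        = ν.real ((t • ·) ⁻¹' (S (t • x) \ S (t • y))) := (hpre t ((hS _).diff (hS _))).symm
      _ ≤ ν.real (((t • ·) ⁻¹' S (t • x) \ S x) ∪ (S x \ S y)) := by
        refine measureReal_mono fun w hw => ?_
        by_cases hx : w ∈ S x
        · exact Or.inr ⟨hx, fun hy => hw.2 (hsub t y hy)⟩
        · exact Or.inl ⟨hw.1, hx⟩
      _ ≤ _ := measureReal_union_le _ _
      _ = ν.real (S x \ S y) := by rw [h0, zero_add]

theorem graph_subset_regionallyProximal_of_measurePreserving [ContinuousConstSMul T X]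
    [ν.Regular] [ν.IsOpenPosMeasure]
    (hmin : MulAction.IsMinimal T X)
    (hT : ∀ t : T, MeasurePreserving (fun x : X => t • x) ν ν) :
    (equicontinuousStructureRelation T X).graph ⊆ regionallyProximal T X := by
  rintro ⟨x, y⟩ hxy
  refine mem_regionallyProximal_iff.2 fun α hα O hO => ?_
  obtain ⟨U, V, -, hxU, hV, hyV, hUV⟩ := mem_nhds_prod_iff'.1 hO
  set A : Set (X × X) := {p | ∃ t : T, ∃ v ∈ V, (t • x, t • v) = p} with hA
  have hNT : ∀ p ∈ closure A, ∀ t : T, (t • p.1, t • p.2) ∈ closure A := by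
    intro p hp t
    have hcont : Continuous fun p : X × X => (t • p.1, t • p.2) := by fun_prop
    refine map_mem_closure (f := fun p : X × X => (t • p.1, t • p.2)) hcont hp ?_
    rintro _ ⟨s, v, hv, rfl⟩
    exact ⟨t * s, v, hv, by simp only [mul_smul]⟩
  have hVN : V ⊆ Prod.mk x ⁻¹' closure A := fun v hv =>
    subset_closure ⟨1, v, hv, by simp only [one_smul]⟩
  have h0 := measureReal_slice_diff_eq_zero (ν := ν) hmin hT isClosed_closure hNT hxy
  have hNy : IsClosed (Prod.mk y ⁻¹' closure A) := isClosed_closure.preimage (by fun_prop)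
  -- The slice at `x` contains `V`, so the slice at `y` contains almost all of `V`. Full support
  -- leaves no room for the open set `V` minus that slice, so `y` itself lies in the slice.
  have hyy : (y, y) ∈ closure A := by
    by_contra hyy
    have hpos := (hV.sdiff hNy).measure_pos ν ⟨y, hyV, hyy⟩
    rw [measureReal_eq_zero_iff] at h0
    exact hpos.ne' (measure_mono_null (sdiff_subset_sdiff_left hVN) h0)
  obtain ⟨_, hp, t, v, hv, rfl⟩ := mem_closure_iff_nhds.1 hyy _
    (mem_nhdsSet_iff_forall.1 hα (y, y) rfl)
  exact ⟨(x, v), hUV ⟨hxU, hv⟩, t, hp⟩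

end Regular

theorem AdmitsInvariantMeasure.surjective_and_graph_subset [T2Space X] [ContinuousConstSMul T X]
    (h : AdmitsInvariantMeasure T X) (hmin : MulAction.IsMinimal T X) :
    (∀ t : T, Function.Surjective fun x : X => t • x) ∧
      (equicontinuousStructureRelation T X).graph ⊆ regionallyProximal T X := by
  let : MeasurableSpace X := borel X
  have : BorelSpace X := ⟨rfl⟩
  obtain ⟨μ, hμ, hinv⟩ := h
  obtain ⟨ν, hν, _, _, hT⟩ := exists_regular_measurePreserving (T := T) μ fun t =>
    ⟨(continuous_const_smul t).measurable, Measure.ext fun B hB => by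
      rw [Measure.map_apply (continuous_const_smul t).measurable hB]
      exact hinv.measure_preimage_smul t hB⟩
  have := isOpenPosMeasure_of_isMinimal hmin hν hT
  exact ⟨fun t => smul_surjective_of_measurePreserving (hT t),
    graph_subset_regionallyProximal_of_measurePreserving hmin hT⟩

end InvariantMeasure

end Semiflow

theorem theorem1p4 (T : Type u) (X : Type v)
    [Monoid T] [TopologicalSpace T] [ContinuousMul T]
    [TopologicalSpace X] [CompactSpace X] [T2Space X]
    [MulAction T X] [ContinuousSMul T X] (hmin : MulAction.IsMinimal T X)
    (h : Semiflow.AdmitsInvariantMeasure T X ∨ Semiflow.IsAmenable.{u, v} T ∨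
      Semiflow.IsDistal T X) :
    {p : X × X | (Semiflow.equicontinuousStructureRelation T X).toSetoid p.1 p.2} =
        Semiflow.regionallyProximal T X ∧
      Semiflow.IsEquicontinuous T (Semiflow.MaximalEquicontinuousFactor T X) ∧
      Semiflow.IsInvertible T (Semiflow.MaximalEquicontinuousFactor T X) := by
  obtain ⟨hsurj, hsub⟩ : (∀ t : T, Function.Surjective fun x : X => t • x) ∧
      (Semiflow.equicontinuousStructureRelation T X).graph ⊆
        Semiflow.regionallyProximal T X := by
    rcases h with h | h | h
    · exact h.surjective_and_graph_subset hmin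
    -- Amenability only concerns nonempty phase spaces, while minimality permits an empty one.
    · rcases isEmpty_or_nonempty X with hX | hX
      · exact ⟨fun _ x => isEmptyElim x, fun p => isEmptyElim p.1⟩
      · exact (h X).surjective_and_graph_subset hmin
    · exact ⟨h.smul_surjective, h.graph_subset_regionallyProximal hmin⟩
  exact ⟨hsub.antisymm (Semiflow.regionallyProximal_subset_graph hsurj),
    Semiflow.isEquicontinuous_maximalEquicontinuousFactor,
    Semiflow.isInvertible_maximalEquicontinuousFactor hsurj⟩
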